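/- Let $\mathcal X$ and $\mathcal Y$ be compact subsets of real normed spaces (e.g. of Euclidean spaces), and let $c:\mathcal X\times\mathcal Y\to\mathbb R$ be of class $\mathscr C^1$, i.e. the restriction of a continuously differentiable function defined on an open neighbourhood of $\mathcal X\times\mathcal Y$. Then there exists $\kappa\ge 0$, depending only on $c$, such that $c$ is $\kappa$-Lipschitz (for the maximum norm $\max(\|x\|,\|y\|)$ on pairs, hence also for the Euclidean and sum norms) and such that the following holds for every $\lambda\ge 0$, every probability space $(\mathcal Z,\zeta)$, every Borel probability measure $\nu$ on $\mathcal Y$ and every family $(g_\theta)_{\theta\in\Theta}$ of measurable maps $g_\theta:\mathcal Z\to\mathcal X$. For $\theta\in\Theta$ let $$W_c^\lambda(\theta)=\mathrm{OT}_c^\lambda(\mu_\theta,\nu)=\inf_{\pi\in\Pi(\mu_\theta,\nu)}\int c\,d\pi+\lambda H(\pi\,|\,\mu_\theta\otimes\nu),\qquad \mu_\theta=g_\theta\sharp\zeta,$$ where $\Pi(\mu_\theta,\nu)$ is the set of probability measures on $\mathcal X\times\mathcal Y$ with marginals $\mu_\theta$ and $\nu$, and $H(\pi\,|\,\rho)=\int\big(\log\frac{d\pi}{d\rho}-1\big)\,d\pi+1$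 is the relative entropy ($+\infty$ if $\pi\not\ll\rho$ or $\log\frac{d\pi}{d\rho}$ is not $\pi$-integrable; the entropy term is absent when $\lambda=0$). Then $W_c^\lambda(\theta)$ is finite for all $\theta$, and for all $\theta_1,\theta_2\in\Theta$ $$|W_c^\lambda(\theta_1)-W_c^\lambda(\theta_2)|\le\kappa\,\mathbf E_{Z\sim\zeta}\big[\|g_{\theta_1}(Z)-g_{\theta_2}(Z)\|\big].$$ Consequently Lipschitz regularity of the generator transfers to $W_c^\lambda$: if $\Theta$ is a (pseudo)metric space with distance $d$, $S\subseteq\Theta$, and $L:\mathcal Z\to[0,\infty)$ is $\zeta$-integrable with $\|g_{\theta_1}(z)-g_{\theta_2}(z)\|\le L(z)\,d(\theta_1,\theta_2)$ for all $\theta_1,\theta_2\in S$ and $\zeta$-almost every $z$ (the null set may depend on $\theta_1,\theta_2$), then $|W_c^\lambda(\theta_1)-W_c^\lambda(\theta_2)|\le\kappa\,\mathbf E_{Z\sim\zeta}[L(Z)]\,d(\theta_1,\theta_2)$ for all $\theta_1,\theta_2\in S$. -/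

import Mathlib

open MeasureTheory
open scoped NNReal ENNReal

namespace EntropicOT

/-- The set of couplings of `μ` and `ν`: probability measures on the product space having
marginals `μ` and `ν`. -/
def couplings {A B : Type*} [MeasurableSpace A] [MeasurableSpace B]
    (μ : Measure A) (ν : Measure B) : Set (Measure (A × B)) :=
  {π | IsProbabilityMeasure π ∧ π.fst = μ ∧ π.snd = ν}

/-- The optimal transport cost with entropic regularization,
`inf { ∫ c dπ + lam * H(π | μ ⊗ ν) : π a coupling of μ and ν }`, as an extended real number.
The relative entropy `H` is the Kullback-Leibler divergence, which for probability measures is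
`∫ (log (dπ / d(μ ⊗ ν)) - 1) dπ + 1` if `π ≪ μ ⊗ ν` and the logarithm is `π`-integrable, and `∞`
otherwise. As `0 * ⊤ = 0` in `EReal`, the value `lam = 0` gives the unregularized cost. -/
noncomputable def cost {A B : Type*} [MeasurableSpace A] [MeasurableSpace B]
    (lam : ℝ) (c : A × B → ℝ) (μ : Measure A) (ν : Measure B) : EReal :=
  ⨅ π ∈ couplings μ ν,
    ((∫ p, c p ∂π : ℝ) : EReal) +
      (lam : EReal) * ((InformationTheory.klDiv π (μ.prod ν) : ℝ≥0∞) : EReal)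

/-- The regularized optimal transport cost `W(θ)` between the law `g_θ ♯ ζ` of the generator
`g_θ` and the target `ν`. -/
noncomputable def genCost {A B Z Θ : Type*} [MeasurableSpace A] [MeasurableSpace B]
    [MeasurableSpace Z] (lam : ℝ) (c : A × B → ℝ) (ζ : Measure Z) (ν : Measure B)
    (g : Θ → Z → A) (θ : Θ) : EReal :=
  cost lam c (ζ.map (g θ)) ν

/-- `c` is of class `C¹` on `X × Y`, for (closed) subsets `X`, `Y` of normed spaces: it is the
restriction of a continuously differentiable function on an open neighbourhood of `X × Y`. -/
def IsC1 {E F : Type*} [NormedAddCommGroup E] [NormedSpace ℝ E]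
    [NormedAddCommGroup F] [NormedSpace ℝ F] (X : Set E) (Y : Set F) (c : X × Y → ℝ) : Prop :=
  ∃ (U : Set (E × F)) (C : E × F → ℝ), IsOpen U ∧ X ×ˢ Y ⊆ U ∧ ContDiffOn ℝ 1 C U ∧
    ∀ p : X × Y, c p = C ((p.1 : E), (p.2 : F))

end EntropicOT

/-!
The proof transports couplings rather than dual potentials. Let `π` be a coupling of
`μ₂ = g₂ ♯ ζ` and `ν`. Disintegrate it as `π = μ₂ ⊗ K`; then `γ = ζ ⊗ (K ∘ g₂)` is a coupling of
`ζ` and `ν` on the latent space, with image `π` under `g₂ × id`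
(`exists_coupling_map_eq_of_map_left`). If `π` has density `f` with respect to `μ₂ ⊗ ν`, then `γ`
has density `f ∘ (g₂ × id)` with respect to `ζ ⊗ ν`, so lifting does not increase the relative
entropy. The image of `γ` under `g₁ × id` is a coupling of `μ₁ = g₁ ♯ ζ` and `ν`; its entropy is
at most that of `γ` by the data processing inequality, and since `c` is `κ`-Lipschitz its transport
cost exceeds that of `π` by at most `κ * E[dist (g₁ Z) (g₂ Z)]`. Taking the infimum over `π` and
exchanging the roles of `g₁` and `g₂` gives the estimate, for all `lam ≥ 0` at once
(`cost_map_le_cost_map_add`).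

The constant `κ` comes from the fact that a `C¹` function is locally Lipschitz, hence Lipschitz on
compact sets (`IsC1.exists_lipschitzWith`). Finiteness holds because `c` is bounded: the product
coupling has zero entropy, and entropies are nonnegative.
-/

namespace EntropicOT

open ProbabilityTheory InformationTheory

/-! ### Lifting couplings along a map -/

section Lift

variable {A B Z : Type*} [MeasurableSpace A] [MeasurableSpace B] [MeasurableSpace Z]

lemma prod_mem_couplings (μ : Measure A) (ν : Measure B) [IsProbabilityMeasure μ]
    [IsProbabilityMeasure ν] : μ.prod ν ∈ couplings μ ν :=
  ⟨inferInstance, by simp, by simp⟩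

/-- Pushing the first coordinate of a coupling forward, together with the data processing
inequality for the relative entropy to the product measure. -/
lemma map_mem_couplings_and_klDiv_le {ζ : Measure Z} [IsProbabilityMeasure ζ] {ν : Measure B}
    [IsProbabilityMeasure ν] {g : Z → A} (hg : Measurable g) {γ : Measure (Z × B)}
    (hγ : γ ∈ couplings ζ ν) :
    γ.map (Prod.map g id) ∈ couplings (ζ.map g) ν ∧
      klDiv (γ.map (Prod.map g id)) ((ζ.map g).prod ν) ≤ klDiv γ (ζ.prod ν) := by
  obtain ⟨hγp, rfl, rfl⟩ := hγ
  have hG : Measurable (Prod.map g (id : B → B)) := hg.prodMap measurable_id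
  refine ⟨⟨Measure.isProbabilityMeasure_map hG.aemeasurable, ?_, ?_⟩, ?_⟩
  · rw [Measure.fst, Measure.fst, Measure.map_map measurable_fst hG,
      Measure.map_map hg measurable_fst]
    rfl
  · rw [Measure.snd, Measure.snd, Measure.map_map measurable_snd hG]
    rfl
  · have h := klDiv_map_le γ (γ.fst.prod γ.snd) hG
    rwa [← Measure.map_prod_map _ _ hg measurable_id, Measure.map_id] at h

lemma map_compProd_comap (ζ : Measure Z) [SFinite ζ] {g : Z → A} (hg : Measurable g)
    (K : Kernel A B) [IsSFiniteKernel K] :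
    (ζ ⊗ₘ K.comap g hg).map (Prod.map g id) = ζ.map g ⊗ₘ K := by
  ext s hs
  have hG : Measurable (Prod.map g (id : B → B)) := hg.prodMap measurable_id
  rw [Measure.map_apply hG hs, Measure.compProd_apply (hG hs), Measure.compProd_apply hs,
    lintegral_map (Kernel.measurable_kernel_prodMk_left hs) hg]
  rfl

/-- If `(g ♯ ζ) ⊗ K` has density `f` with respect to `(g ♯ ζ) ⊗ ν`, then its lift `ζ ⊗ (K ∘ g)` has
density `f ∘ (g × id)` with respect to `ζ ⊗ ν`. -/
lemma compProd_comap_eq_withDensity {ζ : Measure Z} [IsFiniteMeasure ζ] {ν : Measure B}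
    [IsFiniteMeasure ν] {g : Z → A} (hg : Measurable g) {K : Kernel A B} [IsFiniteKernel K]
    {f : A × B → ℝ≥0∞} (hf : Measurable f)
    (h : ζ.map g ⊗ₘ K = ((ζ.map g).prod ν).withDensity f) :
    ζ ⊗ₘ K.comap g hg = (ζ.prod ν).withDensity (f ∘ Prod.map g id) := by
  have hG : Measurable (Prod.map g (id : B → B)) := hg.prodMap measurable_id
  refine Measure.ext_prod fun {s t} hs ht => ?_
  -- The uniqueness of densities identifies `K x t`, for each fixed `t`.
  have key : (fun x => K x t) =ᵐ[ζ.map g] fun x => ∫⁻ y in t, f (x, y) ∂ν := by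
    refine ae_eq_of_forall_setLIntegral_eq_of_sigmaFinite (K.measurable_coe ht)
      hf.lintegral_prod_right' fun u hu _ => ?_
    rw [← Measure.compProd_apply_prod hu ht, h, withDensity_apply _ (hu.prod ht),
      ← Measure.prod_restrict, lintegral_prod _ hf.aemeasurable]
  rw [Measure.compProd_apply_prod hs ht, withDensity_apply _ (hs.prod ht),
    ← Measure.prod_restrict, lintegral_prod _ (hf.comp hG).aemeasurable]
  refine lintegral_congr_ae (ae_restrict_of_ae ?_)
  filter_upwards [ae_of_ae_map hg.aemeasurable key] with z hz
  simpa using hz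

/-- Every coupling of `g ♯ ζ` and `ν` is the image of a coupling of `ζ` and `ν`, without increase
of the relative entropy. -/
lemma exists_coupling_map_eq_of_map_left [StandardBorelSpace B] {ζ : Measure Z}
    [IsProbabilityMeasure ζ] {ν : Measure B} [IsProbabilityMeasure ν] {g : Z → A}
    (hg : Measurable g) {π : Measure (A × B)} (hπ : π ∈ couplings (ζ.map g) ν) :
    ∃ γ ∈ couplings ζ ν, γ.map (Prod.map g id) = π ∧
      klDiv γ (ζ.prod ν) ≤ klDiv π ((ζ.map g).prod ν) := by
  obtain ⟨hπp, hπ₁, hπ₂⟩ := hπ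
  have : Nonempty B := nonempty_of_isProbabilityMeasure ν
  have : IsProbabilityMeasure (ζ.map g) := Measure.isProbabilityMeasure_map hg.aemeasurable
  have hG : Measurable (Prod.map g (id : B → B)) := hg.prodMap measurable_id
  have hdis : ζ.map g ⊗ₘ π.condKernel = π := hπ₁ ▸ π.disintegrate π.condKernel
  have hmap : (ζ ⊗ₘ π.condKernel.comap g hg).map (Prod.map g id) = π :=
    (map_compProd_comap ζ hg _).trans hdis
  refine ⟨ζ ⊗ₘ π.condKernel.comap g hg, ⟨inferInstance, by simp, ?_⟩, hmap, ?_⟩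
  · rw [← hπ₂]
    conv_rhs => rw [← hmap, Measure.snd, Measure.map_map measurable_snd hG]
    rfl
  by_cases hac : π ≪ (ζ.map g).prod ν
  swap
  · simp [klDiv_of_not_ac hac]
  have hf : Measurable (π.rnDeriv ((ζ.map g).prod ν)) := Measure.measurable_rnDeriv _ _
  have hγ := compProd_comap_eq_withDensity hg hf
    (hdis.trans (Measure.withDensity_rnDeriv_eq _ _ hac).symm)
  have hprod : (ζ.map g).prod ν = (ζ.prod ν).map (Prod.map g id) := by
    rw [← Measure.map_prod_map _ _ hg measurable_id, Measure.map_id]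
  have hφ : Measurable fun p => ENNReal.ofReal
      (klFun (π.rnDeriv ((ζ.map g).prod ν) p).toReal) :=
    (measurable_klFun.comp hf.ennreal_toReal).ennreal_ofReal
  rw [klDiv_eq_lintegral_klFun_of_ac hac,
    klDiv_eq_lintegral_klFun_of_ac (hγ ▸ withDensity_absolutelyContinuous _ _)]
  refine le_of_eq ?_
  calc _ = ∫⁻ p, ENNReal.ofReal
          (klFun (π.rnDeriv ((ζ.map g).prod ν) (Prod.map g id p)).toReal) ∂(ζ.prod ν) := by
        refine lintegral_congr_ae ?_
        rw [hγ]
        filter_upwards [Measure.rnDeriv_withDensity (ζ.prod ν) (hf.comp hG)] with p hp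
        rw [hp, Function.comp_apply]
    _ = _ := by
        rw [← lintegral_map hφ hG, ← hprod]

end Lift

/-! ### Stability of the cost -/

section Stability

variable {A B Z : Type*}
  [PseudoMetricSpace A] [CompactSpace A] [MeasurableSpace A] [BorelSpace A]
  [MetricSpace B] [CompactSpace B] [MeasurableSpace B] [BorelSpace B] [MeasurableSpace Z]

lemma integrable_of_continuous {c : A × B → ℝ} (hc : Continuous c) (π : Measure (A × B))
    [IsFiniteMeasure π] : Integrable c π :=
  hc.integrable_of_hasCompactSupport (HasCompactSupport.of_compactSpace c)

lemma integrable_dist_of_measurable {ζ : Measure Z} [IsFiniteMeasure ζ] {g₁ g₂ : Z → A}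
    (hg₁ : Measurable g₁) (hg₂ : Measurable g₂) : Integrable (fun z => dist (g₁ z) (g₂ z)) ζ := by
  refine Integrable.of_bound (hg₁.dist hg₂).aestronglyMeasurable (Metric.diam (Set.univ : Set A))
    (ae_of_all _ fun z => ?_)
  rw [Real.norm_of_nonneg dist_nonneg]
  exact Metric.dist_le_diam_of_mem isCompact_univ.isBounded trivial trivial

lemma cost_ne_top_and_ne_bot {lam : ℝ} (hlam : 0 ≤ lam) {c : A × B → ℝ} (hc : Continuous c)
    (μ : Measure A) [IsProbabilityMeasure μ] (ν : Measure B) [IsProbabilityMeasure ν] :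
    cost lam c μ ν ≠ ⊤ ∧ cost lam c μ ν ≠ ⊥ := by
  constructor
  · refine ne_top_of_le_ne_top ?_ (iInf₂_le (μ.prod ν) (prod_mem_couplings μ ν))
    simp
  · obtain ⟨M, hM⟩ := (isCompact_range hc).bddBelow
    have hle : ((M : ℝ) : EReal) ≤ cost lam c μ ν := by
      refine le_iInf₂ fun π hπ => ?_
      have := hπ.1
      have h₁ : M ≤ ∫ p, c p ∂π := by
        have := integral_mono (integrable_const M) (integrable_of_continuous hc π)
          fun p => hM ⟨p, rfl⟩
        simpa using this
      calc (M : EReal) = (M : EReal) + 0 := (add_zero _).symm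
        _ ≤ _ := add_le_add (EReal.coe_le_coe_iff.2 h₁)
            (mul_nonneg (EReal.coe_nonneg.2 hlam) (EReal.coe_ennreal_nonneg _))
    exact ne_bot_of_le_ne_bot (EReal.coe_ne_bot M) hle

/-- Replacing the generator `g₂` by `g₁` increases the cost at most by `κ` times their mean
distance: each coupling for `g₂` is lifted to the latent space and pushed forward along `g₁`. -/
lemma cost_map_le_cost_map_add {lam : ℝ} (hlam : 0 ≤ lam) {c : A × B → ℝ} {κ : ℝ≥0}
    (hc : LipschitzWith κ c) {ζ : Measure Z} [IsProbabilityMeasure ζ] {ν : Measure B}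
    [IsProbabilityMeasure ν] {g₁ g₂ : Z → A} (hg₁ : Measurable g₁) (hg₂ : Measurable g₂) :
    cost lam c (ζ.map g₁) ν ≤
      cost lam c (ζ.map g₂) ν + ((κ * ∫ z, dist (g₁ z) (g₂ z) ∂ζ : ℝ) : EReal) := by
  rw [← EReal.sub_le_iff_le_add (.inl (EReal.coe_ne_bot _)) (.inl (EReal.coe_ne_top _))]
  refine le_iInf₂ fun π hπ => EReal.sub_le_of_le_add ?_
  obtain ⟨γ, hγ, rfl, hkl⟩ := exists_coupling_map_eq_of_map_left hg₂ hπ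
  obtain ⟨hπ₁, hkl₁⟩ := map_mem_couplings_and_klDiv_le hg₁ hγ
  refine (iInf₂_le _ hπ₁).trans ?_
  obtain ⟨hγp, hfst, -⟩ := hγ
  have hG₁ : Measurable (Prod.map g₁ (id : B → B)) := hg₁.prodMap measurable_id
  have hG₂ : Measurable (Prod.map g₂ (id : B → B)) := hg₂.prodMap measurable_id
  have : IsProbabilityMeasure (γ.map (Prod.map g₁ id)) := hπ₁.1
  have : IsProbabilityMeasure (γ.map (Prod.map g₂ id)) := hπ.1
  have hc₁ : Integrable (fun p => c (Prod.map g₁ id p)) γ :=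
    (integrable_of_continuous hc.continuous (γ.map (Prod.map g₁ id))).comp_measurable hG₁
  have hc₂ : Integrable (fun p => c (Prod.map g₂ id p)) γ :=
    (integrable_of_continuous hc.continuous (γ.map (Prod.map g₂ id))).comp_measurable hG₂
  have hd : Integrable (fun p : Z × B => dist (g₁ p.1) (g₂ p.1)) γ :=
    integrable_dist_of_measurable (hg₁.comp measurable_fst) (hg₂.comp measurable_fst)
  have hdist : ∫ z, dist (g₁ z) (g₂ z) ∂ζ = ∫ p, dist (g₁ p.1) (g₂ p.1) ∂γ := by
    rw [← hfst, Measure.fst, integral_map measurable_fst.aemeasurable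
      (hg₁.dist hg₂).aestronglyMeasurable]
  have hreal : ∫ p, c p ∂γ.map (Prod.map g₁ id) ≤
      ∫ p, c p ∂γ.map (Prod.map g₂ id) + κ * ∫ z, dist (g₁ z) (g₂ z) ∂ζ := by
    rw [integral_map hG₁.aemeasurable hc.continuous.aestronglyMeasurable,
      integral_map hG₂.aemeasurable hc.continuous.aestronglyMeasurable, hdist,
      ← integral_const_mul, ← integral_add hc₂ (hd.const_mul _)]
    refine integral_mono hc₁ (hc₂.add (hd.const_mul _)) fun p => ?_
    simpa [Prod.dist_eq] using hc.le_add_mul (Prod.map g₁ id p) (Prod.map g₂ id p)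
  calc _ ≤ ((∫ p, c p ∂γ.map (Prod.map g₂ id) + κ * ∫ z, dist (g₁ z) (g₂ z) ∂ζ : ℝ) : EReal) +
        (lam : EReal) * ((klDiv (γ.map (Prod.map g₂ id)) ((ζ.map g₂).prod ν) : ℝ≥0∞) : EReal) :=
        add_le_add (EReal.coe_le_coe_iff.2 hreal) (mul_le_mul_of_nonneg_left
          (EReal.coe_ennreal_le_coe_ennreal_iff.2 (hkl₁.trans hkl)) (EReal.coe_nonneg.2 hlam))
    _ = _ := by rw [EReal.coe_add, add_right_comm]

lemma abs_toReal_cost_map_sub_le {lam : ℝ} (hlam : 0 ≤ lam) {c : A × B → ℝ} {κ : ℝ≥0}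
    (hc : LipschitzWith κ c) {ζ : Measure Z} [IsProbabilityMeasure ζ] {ν : Measure B}
    [IsProbabilityMeasure ν] {g₁ g₂ : Z → A} (hg₁ : Measurable g₁) (hg₂ : Measurable g₂) :
    |(cost lam c (ζ.map g₁) ν).toReal - (cost lam c (ζ.map g₂) ν).toReal| ≤
      κ * ∫ z, dist (g₁ z) (g₂ z) ∂ζ := by
  have hp₁ : IsProbabilityMeasure (ζ.map g₁) := Measure.isProbabilityMeasure_map hg₁.aemeasurable
  have hp₂ : IsProbabilityMeasure (ζ.map g₂) := Measure.isProbabilityMeasure_map hg₂.aemeasurable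
  have h₁₂ := cost_map_le_cost_map_add (ν := ν) hlam hc (ζ := ζ) hg₁ hg₂
  have h₂₁ := cost_map_le_cost_map_add (ν := ν) hlam hc (ζ := ζ) hg₂ hg₁
  obtain ⟨ht₁, hb₁⟩ := cost_ne_top_and_ne_bot hlam hc.continuous (ζ.map g₁) ν
  obtain ⟨ht₂, hb₂⟩ := cost_ne_top_and_ne_bot hlam hc.continuous (ζ.map g₂) ν
  simp only [dist_comm (g₂ _)] at h₂₁
  rw [← EReal.coe_toReal ht₁ hb₁, ← EReal.coe_toReal ht₂ hb₂, ← EReal.coe_add,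
    EReal.coe_le_coe_iff] at h₁₂ h₂₁
  exact abs_sub_le_iff.2 ⟨by linarith, by linarith⟩

end Stability

/-! ### Lipschitz constants of `C¹` costs -/

lemma IsC1.exists_lipschitzWith {E F : Type*} [NormedAddCommGroup E] [NormedSpace ℝ E]
    [NormedAddCommGroup F] [NormedSpace ℝ F] {X : Set E} {Y : Set F} (hX : IsCompact X)
    (hY : IsCompact Y) {c : X × Y → ℝ} (hc : IsC1 X Y c) : ∃ κ : ℝ≥0, LipschitzWith κ c := by
  obtain ⟨U, C, hU, hXY, hC, hcC⟩ := hc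
  obtain ⟨κ, hκ⟩ := LocallyLipschitzOn.exists_lipschitzOnWith_of_compact (f := C) (hX.prod hY) <| by
    intro p hp
    obtain ⟨K, t, ht, hK⟩ :=
      (hC.contDiffAt (hU.mem_nhds (hXY hp))).exists_lipschitzOnWith
    exact ⟨K, t, mem_nhdsWithin_of_mem_nhds ht, hK⟩
  refine ⟨κ, LipschitzWith.of_dist_le_mul fun p q => ?_⟩
  rw [hcC, hcC]
  exact hκ.dist_le_mul _ ⟨p.1.2, p.2.2⟩ _ ⟨q.1.2, q.2.2⟩

end EntropicOT

theorem theorem2 {E : Type*} {F : Type*}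
    [NormedAddCommGroup E] [NormedSpace ℝ E] [MeasurableSpace E] [BorelSpace E]
    [NormedAddCommGroup F] [NormedSpace ℝ F] [MeasurableSpace F] [BorelSpace F]
    (X : Set E) (Y : Set F) (hX : IsCompact X) (hY : IsCompact Y)
    (c : X × Y → ℝ) (hc : EntropicOT.IsC1 X Y c) :
    ∃ κ : ℝ≥0, LipschitzWith κ c ∧
      ∀ (lam : ℝ), 0 ≤ lam →
      ∀ (Z : Type*) [MeasurableSpace Z] (ζ : Measure Z) [IsProbabilityMeasure ζ]
        (ν : Measure Y) [IsProbabilityMeasure ν]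
        (Θ : Type*) (g : Θ → Z → X), (∀ θ, Measurable (g θ)) →
        -- the cost is finite
        (∀ θ, EntropicOT.genCost lam c ζ ν g θ ≠ ⊤ ∧ EntropicOT.genCost lam c ζ ν g θ ≠ ⊥) ∧
        -- its variations are controlled by those of the generator
        (∀ θ₁ θ₂,
          |(EntropicOT.genCost lam c ζ ν g θ₁).toReal -
              (EntropicOT.genCost lam c ζ ν g θ₂).toReal| ≤
            κ * ∫ z, ‖(g θ₁ z : E) - (g θ₂ z : E)‖ ∂ζ) ∧
        -- a Lipschitz generator has a Lipschitz cost
        (∀ [PseudoMetricSpace Θ] (S : Set Θ) (L : Z → ℝ≥0),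
          Integrable (fun z => (L z : ℝ)) ζ →
          (∀ θ₁ ∈ S, ∀ θ₂ ∈ S, ∀ᵐ z ∂ζ,
            ‖(g θ₁ z : E) - (g θ₂ z : E)‖ ≤ L z * dist θ₁ θ₂) →
          ∀ θ₁ ∈ S, ∀ θ₂ ∈ S,
            |(EntropicOT.genCost lam c ζ ν g θ₁).toReal -
                (EntropicOT.genCost lam c ζ ν g θ₂).toReal| ≤
              κ * (∫ z, (L z : ℝ) ∂ζ) * dist θ₁ θ₂) := by
  obtain ⟨κ, hκ⟩ := hc.exists_lipschitzWith hX hY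
  have := isCompact_iff_compactSpace.1 hX
  have := isCompact_iff_compactSpace.1 hY
  refine ⟨κ, hκ, ?_⟩
  intro lam hlam Z _ ζ _ ν _ Θ g hg
  have key : ∀ θ₁ θ₂, |(EntropicOT.genCost lam c ζ ν g θ₁).toReal -
      (EntropicOT.genCost lam c ζ ν g θ₂).toReal| ≤
        κ * ∫ z, ‖(g θ₁ z : E) - (g θ₂ z : E)‖ ∂ζ := by
    intro θ₁ θ₂
    simpa only [EntropicOT.genCost, Subtype.dist_eq, dist_eq_norm] using
      EntropicOT.abs_toReal_cost_map_sub_le hlam hκ (ζ := ζ) (ν := ν) (hg θ₁) (hg θ₂)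
  refine ⟨fun θ => ?_, key, ?_⟩
  · have := Measure.isProbabilityMeasure_map (μ := ζ) (hg θ).aemeasurable
    exact EntropicOT.cost_ne_top_and_ne_bot hlam hκ.continuous _ ν
  · intro _ S L hL hgL θ₁ h₁ θ₂ h₂
    refine (key θ₁ θ₂).trans ?_
    rw [mul_assoc, ← integral_mul_const]
    exact mul_le_mul_of_nonneg_left (integral_mono_of_nonneg
      (ae_of_all _ fun _ => norm_nonneg _) (hL.mul_const _) (hgL θ₁ h₁ θ₂ h₂)) κ.2
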